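/- **Setting.** Fix a many-sorted first-order signature $\Sigma$ (with equality) having a designated *foreground* sort; all other sorts are *background* sorts. Some relation symbols over the foreground sort carry a recursive definition; let $\mathcal D$ be the set of these definitions $R(\bar x):=_{\mathrm{lfp}}\rho_R(\bar x)$, one for each such $R$ (written $R\in\mathcal D$), where $\rho_R$ is quantifier-free and recursively defined relations occur in it only positively. Let $T$ be a first-order theory about background sorts only (its quantifiers range over background sorts and its symbols involve no foreground sort). Let $\mathcal A$ be a set of universal sentences and $\alpha$ a universal sentence, i.e. sentences $\forall\bar x\,\eta$ with $\eta$ quantifier-free and $\bar x$ of foreground sort. All models have non-empty carriers and satisfy $T$. We write $\Phi\cup\mathcal D\models_{\mathrm{FO}}\varphi$ if $\varphi$ holds in all models of $\Phi$ that satisfy $\forall\bar x\,(R(\bar x)\leftrightarrow\rho_R(\bar x))$ for all $R\in\mathcal D$, and $\Phi\cup\mathcal D\models_{\mathrm{LFP}}\varphi$ if $\varphi$ holds in all LFP models of $\Phi$, i.e. models of $\Phi$ in which the relations $R\in\mathcal D$ are the simultaneous least fixpoint of their definitions. A *lemma* is a sentence $L=\forall\bar x\,(R(\bar x)\to\psi(\bar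 x))$ of $\Sigma$ with $R\in\mathcal D$ and $\psi$ quantifier-free. Put $$PFP(L):=\forall\bar x\,\bigl(\rho_R(\bar x,\,R\leftarrow(\psi\wedge R))\to\psi(\bar x)\bigr),\qquad IP(L):=PFP(L)\to L,$$ where the substitution replaces every occurrence $R(\bar t)$ in $\rho_R$ by $\psi(\bar t)\wedge R(\bar t)$. Write $PFP(L[\bar c])$ for the matrix of $PFP(L)$ at constants $\bar c$, and $IP(L,\bar c):=\forall\bar x\,(\neg PFP(L[\bar c])\vee L(\bar x))$ for the Skolemized induction principle. We say that $\alpha$ is *provable from $\mathcal A$ and $\mathcal D$ by a finite sequence of inductive lemmas* if there are lemmas $L_1,\dots,L_n$ with $\mathcal A\cup\mathcal D\cup\{L_1,\dots,L_{i-1}\}\models_{\mathrm{FO}}PFP(L_i)$ for all $i$ and $\mathcal A\cup\mathcal D\cup\{L_1,\dots,L_n\}\models_{\mathrm{FO}}\alpha$. For a set $\Phi$ of universal formulas over $\Sigma$ extended by Skolem constants of foreground sort, $T_k(\Phi)$ is the set of all ground terms of foreground sort and depth at most $k$ over the extended signature, $\Phi[T_k(\Phi)]$ is the set of all instances of formulas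 of $\Phi$ by tuples of terms from $T_k(\Phi)$, and SAT means satisfiability modulo $T$. Negated universal formulas are Skolemized by constants. **Algorithm** (input $\mathcal A,\mathcal D,\alpha,k$ and a set $\mathcal G$ of LFP models of $\mathcal A\cup\mathcal D$). Start with $\mathcal L=\mathcal{IP}=\emptyset$ and $C_R=\emptyset$ for all $R\in\mathcal D$. Let $\Phi_\alpha$ always denote $\mathcal A\cup\mathcal D\cup\mathcal L\cup\mathcal{IP}\cup\{\neg\alpha\}$ for the current $\mathcal L,\mathcal{IP}$. While $\Phi_\alpha[T_k(\Phi_\alpha)]$ is satisfiable: 1. get any model $M$ of $\Phi_\alpha[T_k(\Phi_\alpha)]$, and let $U_k$ be the set of values in $M$ of the terms in $T_k(\Phi_\alpha)$; 2. select a lemma $L=\forall\bar x\,(R(\bar x)\to\psi(\bar x))$ that is a *candidate*, i.e. (a) $M\not\models L[\bar u]$ for some tuple $\bar u$ from $U_k$, (b) $M\models PFP(L[\bar c])$ for all $\bar c\in C_R$, and (c) $G\models L$ for all $G\in\mathcal G$; if there is none, stop without a proof; 3. let $\bar c_L$ be a tuple of fresh constants and $\Phi_L:=\mathcal A\cup\mathcal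 D\cup\mathcal L\cup\{\neg PFP(L[\bar c_L])\}$. If $\Phi_L[T_k(\Phi_L)]$ is satisfiable, add $IP(L,\bar c_L)$ to $\mathcal{IP}$ and $\bar c_L$ to $C_R$; otherwise add $L$ to $\mathcal L$ and reset $\mathcal{IP}$ and all $C_R$ to $\emptyset$. When the loop ends, return $\mathcal L$ and $\mathcal{IP}$. The selection in step 2 is *fair* if a candidate is selected whenever there is one, and for each lemma $L$ there are only finitely many other lemmas that might be selected when $L$ is a candidate. **Theorem.** Assume that there is at least one ground term of foreground sort over $\Sigma$ extended by the Skolem constants of $\neg\alpha$. If $\alpha$ is provable from $\mathcal A$ and $\mathcal D$ by a finite sequence of inductive lemmas, then there is an instantiation depth $k$ such that for every set $\mathcal G$ of LFP models of $\mathcal A\cup\mathcal D$, every fair lemma selection and every choice of the models $M$, the algorithm terminates and returns a finite set $\mathcal L$ of lemmas and a finite set $\mathcal{IP}$ of induction principles that together prove $\alpha$: $\mathcal A\cup\mathcal D\models_{\mathrm{LFP}}L$ for each $L\in\mathcal L$, and $\mathcal A\cup\mathcal D\cup\mathcal L\cup\mathcal{IP}\models_{\mathrm{FO}}\alpha$,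 where in the last entailment the induction principles are taken in their unskolemized form $IP(L)$. -/

import Mathlib

universe u v w

namespace LemmaSynth

/-- A many-sorted signature with a designated foreground sort `fg`; every other sort is a background
sort. Constants are function symbols of arity `0`. The relation symbols are split into those without
(`Rel`) and those with (`DRel`) a recursive definition; the latter are relations over the foreground
sort. -/
structure Sig : Type (u + 1) where
  Srt : Type u
  fg : Srt
  Fn : Type u
  fnAr : Fn → ℕ
  fnDom : (f : Fn) → Fin (fnAr f) → Srt
  fnCod : Fn → Srt
  Rel : Type u
  relAr : Rel → ℕ
  relDom : (R : Rel) → Fin (relAr R) → Srt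
  DRel : Type u
  dAr : DRel → ℕ

/-- Well-sorted terms over the variables (or additional constants) `V σ` of sort `σ`. -/
inductive Term (S : Sig.{u}) (V : S.Srt → Type v) : S.Srt → Type (max u v)
  | var {σ : S.Srt} (x : V σ) : Term S V σ
  | app (f : S.Fn) (ts : ∀ i : Fin (S.fnAr f), Term S V (S.fnDom f i)) : Term S V (S.fnCod f)

/-- Constants and variables have depth `0`. -/
def Term.depth {S : Sig.{u}} {V : S.Srt → Type v} : {σ : S.Srt} → Term S V σ → ℕ
  | _, .var _ => 0
  | _, .app _ ts => Finset.univ.sup fun i => (ts i).depth + 1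

def Term.subst {S : Sig.{u}} {V : S.Srt → Type v} {W : S.Srt → Type w}
    (s : ∀ σ, V σ → Term S W σ) : {σ : S.Srt} → Term S V σ → Term S W σ
  | _, .var x => s _ x
  | _, .app f ts => .app f fun i => (ts i).subst s

/-- First-order structures, with non-empty carriers. -/
structure Structure (S : Sig.{u}) : Type (u + 1) where
  carrier : S.Srt → Type u
  nonempty : ∀ σ, Nonempty (carrier σ)
  fn : (f : S.Fn) → (∀ i : Fin (S.fnAr f), carrier (S.fnDom f i)) → carrier (S.fnCod f)
  rel : (R : S.Rel) → (∀ i : Fin (S.relAr R), carrier (S.relDom R i)) → Prop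
  drel : (R : S.DRel) → (Fin (S.dAr R) → carrier S.fg) → Prop

def Term.eval {S : Sig.{u}} {V : S.Srt → Type v} (M : Structure S)
    (e : ∀ σ, V σ → M.carrier σ) : {σ : S.Srt} → Term S V σ → M.carrier σ
  | _, .var x => e _ x
  | _, .app f ts => M.fn f fun i => (ts i).eval M e

/-! ### Background theories -/

/-- First-order formulas for background theories; variables of each sort are named by `ℕ`. -/
inductive BForm (S : Sig.{u}) : Type u
  | fls : BForm S
  | eq {σ : S.Srt} (t s : Term S (fun _ => ℕ) σ) : BForm S
  | rel (R : S.Rel) (ts : ∀ i : Fin (S.relAr R), Term S (fun _ => ℕ) (S.relDom R i)) : BForm S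
  | imp (φ ψ : BForm S) : BForm S
  | all (σ : S.Srt) (n : ℕ) (φ : BForm S) : BForm S

/-- Only background sorts are involved in the term. -/
def Term.IsBackground {S : Sig.{u}} {V : S.Srt → Type v} : {σ : S.Srt} → Term S V σ → Prop
  | σ, .var _ => σ ≠ S.fg
  | _, .app f ts => S.fnCod f ≠ S.fg ∧ (∀ i, S.fnDom f i ≠ S.fg) ∧ ∀ i, (ts i).IsBackground

/-- Only background sorts are involved in the formula, in its quantifiers and in its symbols. -/
def BForm.IsBackground {S : Sig.{u}} : BForm S → Prop
  | .fls => True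
  | .eq t s => t.IsBackground ∧ s.IsBackground
  | .rel R ts => (∀ i, S.relDom R i ≠ S.fg) ∧ ∀ i, (ts i).IsBackground
  | .imp φ ψ => φ.IsBackground ∧ ψ.IsBackground
  | .all σ _ φ => σ ≠ S.fg ∧ φ.IsBackground

def BForm.Holds {S : Sig.{u}} (M : Structure S) : (∀ σ, ℕ → M.carrier σ) → BForm S → Prop
  | _, .fls => False
  | e, .eq t s => t.eval M e = s.eval M e
  | e, .rel R ts => M.rel R fun i => (ts i).eval M e
  | e, .imp φ ψ => φ.Holds M e → ψ.Holds M e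
  | e, .all σ n φ => ∀ e' : ∀ τ, ℕ → M.carrier τ,
      (∀ τ m, ¬ (τ = σ ∧ m = n) → e' τ m = e τ m) → φ.Holds M e'

/-! ### Quantifier-free formulas -/

/-- The family of variables that has `X` at the foreground sort and nothing at any other sort. -/
inductive FgOnly (S : Sig.{u}) (X : Type v) : S.Srt → Type v
  | mk (x : X) : FgOnly S X S.fg

def FgOnly.lift {S : Sig.{u}} {X : Type v} {C : S.Srt → Type w} (f : X → C S.fg) :
    ∀ σ, FgOnly S X σ → C σ
  | _, .mk x => f x

/-- Terms of foreground sort over the foreground variables (or additional constants) `X`.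
If the elements of `X` are regarded as constants, these are ground terms. -/
abbrev FTerm (S : Sig.{u}) (X : Type v) : Type (max u v) := Term S (FgOnly S X) S.fg

/-- An element of `X` as a term. -/
def FTerm.sym {S : Sig.{u}} {X : Type v} (x : X) : FTerm S X := .var (.mk x)

/-- Quantifier-free formulas over the foreground variables (or additional constants) `X`. -/
inductive QF (S : Sig.{u}) (X : Type v) : Type (max u v)
  | fls : QF S X
  | eq {σ : S.Srt} (t s : Term S (FgOnly S X) σ) : QF S X
  | rel (R : S.Rel) (ts : ∀ i : Fin (S.relAr R), Term S (FgOnly S X) (S.relDom R i)) : QF S X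
  | drel (R : S.DRel) (ts : Fin (S.dAr R) → FTerm S X) : QF S X
  | not (φ : QF S X) : QF S X
  | and (φ ψ : QF S X) : QF S X
  | or (φ ψ : QF S X) : QF S X

/-- `φ → ψ`. -/
def QF.imp {S : Sig.{u}} {X : Type v} (φ ψ : QF S X) : QF S X := .or (.not φ) ψ

/-- `φ ↔ ψ`. -/
def QF.iff {S : Sig.{u}} {X : Type v} (φ ψ : QF S X) : QF S X := .and (φ.imp ψ) (ψ.imp φ)

def QF.subst {S : Sig.{u}} {X : Type v} {Y : Type w} (s : X → FTerm S Y) : QF S X → QF S Y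
  | .fls => .fls
  | .eq t t' => .eq (t.subst (FgOnly.lift s)) (t'.subst (FgOnly.lift s))
  | .rel R ts => .rel R fun i => (ts i).subst (FgOnly.lift s)
  | .drel R ts => .drel R fun i => (ts i).subst (FgOnly.lift s)
  | .not φ => .not (φ.subst s)
  | .and φ ψ => .and (φ.subst s) (ψ.subst s)
  | .or φ ψ => .or (φ.subst s) (ψ.subst s)

def QF.Holds {S : Sig.{u}} {X : Type v} (M : Structure S) (e : X → M.carrier S.fg) : QF S X → Prop
  | .fls => False
  | .eq t t' => t.eval M (FgOnly.lift e) = t'.eval M (FgOnly.lift e)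
  | .rel R ts => M.rel R fun i => (ts i).eval M (FgOnly.lift e)
  | .drel R ts => M.drel R fun i => (ts i).eval M (FgOnly.lift e)
  | .not φ => ¬ φ.Holds M e
  | .and φ ψ => φ.Holds M e ∧ ψ.Holds M e
  | .or φ ψ => φ.Holds M e ∨ ψ.Holds M e

/-- With `b = true`: recursively defined relations occur only positively in the formula.
With `b = false`: they occur only negatively. -/
def QF.Polarity {S : Sig.{u}} {X : Type v} : Bool → QF S X → Prop
  | _, .fls => True
  | _, .eq _ _ => True
  | _, .rel _ _ => True
  | b, .drel _ _ => b = true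
  | b, .not φ => φ.Polarity (!b)
  | b, .and φ ψ => φ.Polarity b ∧ ψ.Polarity b
  | b, .or φ ψ => φ.Polarity b ∧ ψ.Polarity b

/-- A sentence `∀ x₁ … xₙ, mat` with quantifier-free `mat`; the variables are of foreground sort. -/
structure USent (S : Sig.{u}) : Type u where
  n : ℕ
  mat : QF S (Fin n)

def USent.Holds {S : Sig.{u}} (M : Structure S) (φ : USent S) : Prop :=
  ∀ e : Fin φ.n → M.carrier S.fg, φ.mat.Holds M e

/-! ### Problems: background theory, axioms, recursive definitions, target -/

/-- The background theory `T`, the axioms `A`, the recursive definitions `R(x̄) :=_lfp body R` and the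
target `α`. -/
structure Problem (S : Sig.{u}) : Type u where
  T : Set (BForm S)
  T_background : ∀ φ ∈ T, φ.IsBackground
  A : Set (USent S)
  body : (R : S.DRel) → QF S (Fin (S.dAr R))
  body_pos : ∀ R, (body R).Polarity true
  α : USent S

/-- The first-order reading `∀ x̄, R(x̄) ↔ ρ_R(x̄)` of a recursive definition. -/
def Problem.defSent {S : Sig.{u}} (P : Problem S) (R : S.DRel) : USent S :=
  ⟨S.dAr R, (QF.drel R FTerm.sym).iff (P.body R)⟩

/-- The background theory holds in `M`. -/
def Problem.Background {S : Sig.{u}} (P : Problem S) (M : Structure S) : Prop :=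
  ∀ φ ∈ P.T, ∀ e, φ.Holds M e

/-- `M` is a model of `A ∪ D` in the first-order semantics. -/
def Problem.FOModel {S : Sig.{u}} (P : Problem S) (M : Structure S) : Prop :=
  P.Background M ∧ (∀ φ ∈ P.A, φ.Holds M) ∧ ∀ R, (P.defSent R).Holds M

/-- The joint operator of all recursive definitions over `M`: the bodies are evaluated with the
recursively defined relations interpreted by `I`. -/
def Problem.op {S : Sig.{u}} (P : Problem S) (M : Structure S)
    (I : (R : S.DRel) → (Fin (S.dAr R) → M.carrier S.fg) → Prop) :
    (R : S.DRel) → (Fin (S.dAr R) → M.carrier S.fg) → Prop :=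
  fun R x => (P.body R).Holds { M with drel := I } x

/-- `M` is a model of `A ∪ D` in the LFP semantics: the recursively defined relations are the
(simultaneous) least fixpoint of their definitions. -/
def Problem.LFPModel {S : Sig.{u}} (P : Problem S) (M : Structure S) : Prop :=
  P.Background M ∧ (∀ φ ∈ P.A, φ.Holds M) ∧ IsLeast (Function.fixedPoints (P.op M)) M.drel

/-! ### Lemmas and induction principles -/

/-- A lemma `∀ x̄, R(x̄) → ψ(x̄)` with recursively defined `R` and quantifier-free `ψ`. -/
structure Lem (S : Sig.{u}) : Type u where
  R : S.DRel
  ψ : QF S (Fin (S.dAr R))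

def Lem.sent {S : Sig.{u}} (L : Lem S) : USent S :=
  ⟨S.dAr L.R, (QF.drel L.R FTerm.sym).imp L.ψ⟩

open Classical in
/-- The replacement `R ← (ψ ∧ R)` of every occurrence `R(t̄)` by `ψ(t̄) ∧ R(t̄)`. -/
noncomputable def Lem.strengthen {S : Sig.{u}} {X : Type v} (L : Lem S) : QF S X → QF S X
  | .fls => .fls
  | .eq t t' => .eq t t'
  | .rel R ts => .rel R ts
  | .drel R ts =>
      if h : L.R = R then
        .and (L.ψ.subst fun i => ts (Fin.cast (congrArg S.dAr h) i)) (.drel R ts)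
      else .drel R ts
  | .not φ => .not (L.strengthen φ)
  | .and φ ψ => .and (L.strengthen φ) (L.strengthen ψ)
  | .or φ ψ => .or (L.strengthen φ) (L.strengthen ψ)

/-- `PFP(L) = ∀ x̄, ρ_R(x̄, R ← (ψ ∧ R)) → ψ(x̄)`. -/
noncomputable def Problem.pfp {S : Sig.{u}} (P : Problem S) (L : Lem S) : USent S :=
  ⟨S.dAr L.R, (L.strengthen (P.body L.R)).imp L.ψ⟩

/-- `M ⊨ IP(L)`, where `IP(L) = PFP(L) → L`. -/
def Problem.IPHolds {S : Sig.{u}} (P : Problem S) (M : Structure S) (L : Lem S) : Prop :=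
  (P.pfp L).Holds M → L.sent.Holds M

/-- `A ∪ D ∪ {L₁, …, Lᵢ₋₁} ⊨_FO PFP(Lᵢ)` for every `i`. -/
def Problem.InductiveSeq {S : Sig.{u}} (P : Problem S) (Ls : List (Lem S)) : Prop :=
  ∀ i : Fin Ls.length, ∀ M : Structure S, P.FOModel M →
    (∀ j : Fin Ls.length, j < i → (Ls.get j).sent.Holds M) → (P.pfp (Ls.get i)).Holds M

/-- `α` is provable from `A` and `D` by a finite sequence of inductive lemmas. -/
def Problem.ProvableByInductiveSeq {S : Sig.{u}} (P : Problem S) : Prop :=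
  ∃ Ls : List (Lem S), P.InductiveSeq Ls ∧
    ∀ M : Structure S, P.FOModel M → (∀ L ∈ Ls, L.sent.Holds M) → P.α.Holds M

/-- The lemmas `Ls` together with the induction principles of the lemmas `Is` prove `α`: the
lemmas are valid in the LFP semantics, and `A ∪ D ∪ Ls ∪ {IP(L) | L ∈ Is} ⊨_FO α`. -/
def Problem.Prove {S : Sig.{u}} (P : Problem S) (Ls Is : List (Lem S)) : Prop :=
  (∀ L ∈ Ls, ∀ M : Structure S, P.LFPModel M → L.sent.Holds M) ∧
    ∀ M : Structure S, P.FOModel M → (∀ L ∈ Ls, L.sent.Holds M) → (∀ L ∈ Is, P.IPHolds M L) →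
      P.α.Holds M

/-! ### Universal formulas with Skolem constants and their instantiation -/

/-- A formula `∀ x₁ … xₙ, mat` over the signature extended by the foreground constants `X`. -/
structure UForm (S : Sig.{u}) (X : Type v) : Type (max u v) where
  n : ℕ
  mat : QF S (X ⊕ Fin n)

/-- A sentence of the original signature, over the extended signature. -/
def USent.over {S : Sig.{u}} (φ : USent S) (X : Type v) : UForm S X :=
  ⟨φ.n, φ.mat.subst fun i => FTerm.sym (Sum.inr i)⟩

/-- The Skolemized negation of a universal sentence, with Skolem constants `c`. -/
def USent.negAt {S : Sig.{u}} {X : Type v} (φ : USent S) (c : Fin φ.n → X) : UForm S X :=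
  ⟨0, .not (φ.mat.subst fun i => FTerm.sym (Sum.inl (c i)))⟩

/-- The Skolemized induction principle `IP(L, c̄) = ∀ x̄, ¬ PFP(L[c̄]) ∨ L(x̄)`. -/
noncomputable def Problem.ip {S : Sig.{u}} {X : Type v} (P : Problem S) (L : Lem S)
    (c : Fin (S.dAr L.R) → X) : UForm S X :=
  ⟨S.dAr L.R,
    .or (.not ((P.pfp L).mat.subst fun i => FTerm.sym (Sum.inl (c i))))
      (L.sent.mat.subst fun i => FTerm.sym (Sum.inr i))⟩

/-- All ground terms of foreground sort and of depth at most `k` over the signature extended by the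
foreground constants `X`. -/
def groundTerms (S : Sig.{u}) (X : Type v) (k : ℕ) : Set (FTerm S X) := {t | t.depth ≤ k}

/-- `Φ[T_k(Φ)]` for a set `Φ` of universal formulas over the signature extended by `X`. -/
def instances {S : Sig.{u}} {X : Type v} (Φ : Set (UForm S X)) (k : ℕ) : Set (QF S X) :=
  {η | ∃ φ ∈ Φ, ∃ t : Fin φ.n → FTerm S X, (∀ i, t i ∈ groundTerms S X k) ∧
    η = φ.mat.subst (Sum.elim FTerm.sym t)}

/-- A structure together with an interpretation of additional foreground constants `X`. -/
structure CStructure (S : Sig.{u}) (X : Type v) : Type (max (u + 1) v) where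
  M : Structure S
  const : X → M.carrier S.fg

/-- `N` is a model of the background theory and of the ground formulas `Ψ`. -/
def Problem.GroundModel {S : Sig.{u}} {X : Type v} (P : Problem S) (N : CStructure S X)
    (Ψ : Set (QF S X)) : Prop :=
  P.Background N.M ∧ ∀ η ∈ Ψ, η.Holds N.M N.const

/-- Satisfiability modulo the background theory. -/
def Problem.SAT {S : Sig.{u}} {X : Type v} (P : Problem S) (Ψ : Set (QF S X)) : Prop :=
  ∃ N : CStructure S X, P.GroundModel N Ψ

/-! ### The algorithm -/

/-- The variables of the algorithm: the discovered lemmas and the lemmas whose induction principles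
are currently in use. -/
structure State (S : Sig.{u}) : Type u where
  lemmas : List (Lem S)
  ips : List (Lem S)

/-- The Skolem constants in the current signature: those for `¬ α`, and a tuple of fresh constants
for each induction principle in use. -/
abbrev Problem.Sk {S : Sig.{u}} (P : Problem S) (s : State S) : Type :=
  Fin P.α.n ⊕ (Σ i : Fin s.ips.length, Fin (S.dAr (s.ips.get i).R))

/-- `Φ_α = A ∪ D ∪ lemmas ∪ {IP(L, c̄_L) | L in use} ∪ {¬ α}`. -/
def Problem.Φα {S : Sig.{u}} (P : Problem S) (s : State S) : Set (UForm S (P.Sk s)) :=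
  {φ | ∃ χ ∈ P.A, φ = χ.over _} ∪ {φ | ∃ R, φ = (P.defSent R).over _} ∪
    {φ | ∃ L ∈ s.lemmas, φ = L.sent.over _} ∪
    {φ | ∃ i : Fin s.ips.length, φ = P.ip (s.ips.get i) fun j => Sum.inr ⟨i, j⟩} ∪
    {P.α.negAt Sum.inl}

/-- `Φ_L = A ∪ D ∪ lemmas ∪ {¬ PFP(L[c̄_L])}`, over the signature extended by the tuple `c̄_L`. -/
def Problem.ΦL {S : Sig.{u}} (P : Problem S) (s : State S) (L : Lem S) :
    Set (UForm S (Fin (S.dAr L.R))) :=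
  {φ | ∃ χ ∈ P.A, φ = χ.over _} ∪ {φ | ∃ R, φ = (P.defSent R).over _} ∪
    {φ | ∃ L' ∈ s.lemmas, φ = L'.sent.over _} ∪
    {(P.pfp L).negAt fun j => j}

/-- `N` is a model that the algorithm may get in state `s`. -/
def Problem.Counterexample {S : Sig.{u}} (P : Problem S) (k : ℕ) (s : State S)
    (N : CStructure S (P.Sk s)) : Prop :=
  P.GroundModel N (instances (P.Φα s) k)

/-- The elements `U_k` of the current model that are denoted by terms in `T_k(Φ_α)`. -/
def Problem.U {S : Sig.{u}} (P : Problem S) (k : ℕ) (s : State S) (N : CStructure S (P.Sk s)) :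
    Set (N.M.carrier S.fg) :=
  {a | ∃ t ∈ groundTerms S (P.Sk s) k, a = t.eval N.M (FgOnly.lift N.const)}

/-- The constraints (a), (b), (c) on the next lemma: it fails on some tuple from `U_k`; its `PFP`
holds at each tuple of Skolem constants that belongs to the same relation; and it holds in all the
models in `G`. -/
def Problem.Candidate {S : Sig.{u}} (P : Problem S) (k : ℕ) (G : Set (Structure S)) (s : State S)
    (N : CStructure S (P.Sk s)) (L : Lem S) : Prop :=
  (∃ a : Fin (S.dAr L.R) → N.M.carrier S.fg, (∀ i, a i ∈ P.U k s N) ∧ ¬ L.sent.mat.Holds N.M a) ∧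
    (∀ (i : Fin s.ips.length) (h : L.R = (s.ips.get i).R),
      (P.pfp L).mat.Holds N.M
        fun j => N.const (Sum.inr ⟨i, Fin.cast (congrArg S.dAr h) j⟩)) ∧
    ∀ M ∈ G, L.sent.Holds M

inductive Config (S : Sig.{u}) : Type u
  | running (s : State S) : Config S
  | output (Ls Is : List (Lem S)) : Config S
  | noProof : Config S

/-- A (non-deterministic) lemma selection procedure: the lemmas that it might select in a given state
with a given model. -/
abbrev Problem.Selection {S : Sig.{u}} (P : Problem S) : Type (u + 1) :=
  (s : State S) → CStructure S (P.Sk s) → Lem S → Prop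

/-- One round of the algorithm. -/
inductive Problem.Step {S : Sig.{u}} (P : Problem S) (k : ℕ) (G : Set (Structure S))
    (sel : P.Selection) : Config S → Config S → Prop
  | done (s : State S) (h : ¬ P.SAT (instances (P.Φα s) k)) :
      Problem.Step P k G sel (.running s) (.output s.lemmas s.ips)
  | fail (s : State S) (N : CStructure S (P.Sk s)) (hN : P.Counterexample k s N)
      (h : ∀ L, ¬ P.Candidate k G s N L) :
      Problem.Step P k G sel (.running s) .noProof
  | addIP (s : State S) (N : CStructure S (P.Sk s)) (hN : P.Counterexample k s N) (L : Lem S)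
      (hL : sel s N L) (h : P.SAT (instances (P.ΦL s L) k)) :
      Problem.Step P k G sel (.running s) (.running ⟨s.lemmas, L :: s.ips⟩)
  | addLemma (s : State S) (N : CStructure S (P.Sk s)) (hN : P.Counterexample k s N) (L : Lem S)
      (hL : sel s N L) (h : ¬ P.SAT (instances (P.ΦL s L) k)) :
      Problem.Step P k G sel (.running s) (.running ⟨L :: s.lemmas, []⟩)

def Config.init (S : Sig.{u}) : Config S := .running ⟨[], []⟩

def Problem.Reachable {S : Sig.{u}} (P : Problem S) (k : ℕ) (G : Set (Structure S))
    (sel : P.Selection) (c : Config S) : Prop :=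
  Relation.ReflTransGen (P.Step k G sel) (Config.init S) c

/-- In the situations that can arise, the procedure selects a lemma that satisfies the constraints,
if there is one; and for each lemma `L` only finitely many other lemmas might be selected when `L`
satisfies the constraints. -/
structure Problem.FairSelection {S : Sig.{u}} (P : Problem S) (k : ℕ) (G : Set (Structure S))
    (sel : P.Selection) : Prop where
  sound : ∀ s N, P.Reachable k G sel (.running s) → P.Counterexample k s N →
    ∀ L, sel s N L → P.Candidate k G s N L
  total : ∀ s N, P.Reachable k G sel (.running s) → P.Counterexample k s N →
    (∃ L, P.Candidate k G s N L) → ∃ L, sel s N L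
  fair : ∀ L, {L' | L' ≠ L ∧ ∃ s N, P.Reachable k G sel (.running s) ∧ P.Counterexample k s N ∧
    P.Candidate k G s N L ∧ sel s N L'}.Finite

/-- Every run of the algorithm is finite. -/
def Problem.Terminates {S : Sig.{u}} (P : Problem S) (k : ℕ) (G : Set (Structure S))
    (sel : P.Selection) : Prop :=
  ¬ ∃ run : ℕ → Config S, run 0 = Config.init S ∧ ∀ m, P.Step k G sel (run m) (run (m + 1))

/-- Whenever a run cannot be continued, it has returned lemmas and induction principles that
prove `α`. -/
def Problem.ReturnsProof {S : Sig.{u}} (P : Problem S) (k : ℕ) (G : Set (Structure S))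
    (sel : P.Selection) : Prop :=
  ∀ c, P.Reachable k G sel c → (∀ c', ¬ P.Step k G sel c c') →
    ∃ Ls Is, c = .output Ls Is ∧ P.Prove Ls Is

end LemmaSynth

open LemmaSynth

namespace LemmaSynth

variable {S : Sig.{u}}

/-! ### Semantics of substitutions -/

/-! Fix a proof of `α` by inductive lemmas `L₁, …, Lₙ`. It consists of finitely many first-order
entailments: each `PFP(Lᵢ)` from `A`, `D` and the earlier lemmas, and `α` from all of them. The
premises are universal, and with its variables replaced by constants each conclusion is ground, so a
compactness argument modulo the background theory (`exists_depth`) gives a depth at which ground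
instances of the premises suffice. Let `k` be the maximum of these depths. Compactness is proved
semantically: an ultraproduct of counterexamples of growing depth satisfies all ground instances,
and restricting its foreground carrier to the values of ground terms gives a genuine model of the
premises, because these are universal and the theory does not see the foreground sort.

At this `k` every model `M` that the algorithm gets has some `Lᵢ` as a candidate
(`exists_depth_candidate`). If all `Lᵢ` held on `U_k`, then `α` would hold at its Skolem constants.
So take the first `Lᵢ` failing on `U_k`; the choice of `k` makes `PFP(Lᵢ)` true at all tuples of
constants, and `Lᵢ` holds in the models in `G` because those are LFP models.

By fairness, all selections then lie in one finite set. A candidate is neither an already discovered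
lemma nor one whose induction principle is in use, so a lexicographic count of the unused lemmas
decreases in every round. Outputs are correct because unsatisfiable instances give entailments, and
a lemma with valid `PFP` holds in LFP models by induction on the least fixpoint. -/

theorem Term.eval_subst {V : S.Srt → Type v} {W : S.Srt → Type w} (M : Structure S)
    (s : ∀ σ, V σ → Term S W σ) (e : ∀ σ, W σ → M.carrier σ) {σ : S.Srt} (t : Term S V σ) :
    (t.subst s).eval M e = t.eval M fun τ x => (s τ x).eval M e := by
  induction t with
  | var x => rfl
  | app f ts ih =>
    simp only [Term.subst, Term.eval]
    congr 1
    funext i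
    exact ih i

theorem FgOnly.eval_lift {X : Type v} {Y : Type w} (M : Structure S) (s : X → FTerm S Y)
    (e : Y → M.carrier S.fg) :
    (fun (τ : S.Srt) (x : FgOnly S X τ) =>
      (FgOnly.lift (C := Term S (FgOnly S Y)) s τ x).eval M (FgOnly.lift e)) =
    FgOnly.lift (C := M.carrier) fun x => (s x).eval M (FgOnly.lift e) := by
  funext τ x
  cases x
  rfl

theorem QF.holds_subst {X : Type v} {Y : Type w} (M : Structure S) (s : X → FTerm S Y)
    (e : Y → M.carrier S.fg) (φ : QF S X) :
    (φ.subst s).Holds M e ↔ φ.Holds M fun x => (s x).eval M (FgOnly.lift e) := by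
  induction φ with
  | fls => rfl
  | eq t t' => simp only [QF.subst, QF.Holds, Term.eval_subst, FgOnly.eval_lift]
  | rel R ts => simp only [QF.subst, QF.Holds, Term.eval_subst, FgOnly.eval_lift]
  | drel R ts => simp only [QF.subst, QF.Holds, Term.eval_subst, FgOnly.eval_lift]
  | not φ ih => simp only [QF.subst, QF.Holds, ih]
  | and φ ψ ih₁ ih₂ => simp only [QF.subst, QF.Holds, ih₁, ih₂]
  | or φ ψ ih₁ ih₂ => simp only [QF.subst, QF.Holds, ih₁, ih₂]

theorem QF.holds_imp {X : Type v} (M : Structure S) (e : X → M.carrier S.fg) (φ ψ : QF S X) :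
    (φ.imp ψ).Holds M e ↔ (φ.Holds M e → ψ.Holds M e) := by
  simp only [QF.imp, QF.Holds]
  tauto

theorem QF.holds_iff {X : Type v} (M : Structure S) (e : X → M.carrier S.fg) (φ ψ : QF S X) :
    (φ.iff ψ).Holds M e ↔ (φ.Holds M e ↔ ψ.Holds M e) := by
  simp only [QF.iff, QF.Holds, QF.holds_imp]
  tauto

theorem Lem.holds_sent_mat (M : Structure S) (L : Lem S) (e : Fin (S.dAr L.R) → M.carrier S.fg) :
    L.sent.mat.Holds M e ↔ (M.drel L.R e → L.ψ.Holds M e) :=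
  QF.holds_imp M e _ _

theorem Term.depth_rename {X : Type v} {Y : Type w} (g : X → Y) {σ : S.Srt}
    (t : Term S (FgOnly S X) σ) :
    (t.subst (FgOnly.lift fun x => FTerm.sym (S := S) (g x))).depth = t.depth := by
  induction t with
  | var x => cases x; rfl
  | app f ts ih => simp only [Term.subst, Term.depth, ih]

/-! ### Replacing the interpretation of the recursively defined relations -/

theorem Term.eval_withDRel {V : S.Srt → Type v} (M : Structure S)
    (I : (R : S.DRel) → (Fin (S.dAr R) → M.carrier S.fg) → Prop)
    (e : ∀ σ, V σ → M.carrier σ) {σ : S.Srt} (t : Term S V σ) :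
    t.eval { M with drel := I } e = t.eval M e := by
  induction t with
  | var x => rfl
  | app f ts ih =>
    simp only [Term.eval]
    congr 1
    funext i
    exact ih i

/-- Both polarities are treated in one induction because negation exchanges them. -/
theorem QF.holds_withDRel_mono {X : Type v} (M : Structure S)
    {I J : (R : S.DRel) → (Fin (S.dAr R) → M.carrier S.fg) → Prop}
    (hIJ : ∀ R a, I R a → J R a) (e : X → M.carrier S.fg) (φ : QF S X) :
    (φ.Polarity true → φ.Holds { M with drel := I } e → φ.Holds { M with drel := J } e) ∧
      (φ.Polarity false → φ.Holds { M with drel := J } e → φ.Holds { M with drel := I } e) := by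
  induction φ with
  | fls => exact ⟨fun _ h => h, fun _ h => h⟩
  | eq t t' =>
    simp only [QF.Holds]
    rw [Term.eval_withDRel M I, Term.eval_withDRel M I, Term.eval_withDRel M J,
      Term.eval_withDRel M J]
    exact ⟨fun _ h => h, fun _ h => h⟩
  | rel R ts =>
    simp only [QF.Holds, Term.eval_withDRel M I, Term.eval_withDRel M J]
    exact ⟨fun _ h => h, fun _ h => h⟩
  | drel R ts =>
    simp only [QF.Holds, Term.eval_withDRel M I, Term.eval_withDRel M J]
    exact ⟨fun _ h => hIJ _ _ h, fun h => absurd h Bool.false_ne_true⟩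
  | not φ ih => exact ⟨fun hp h h' => h (ih.2 hp h'), fun hp h h' => h (ih.1 hp h')⟩
  | and φ ψ ih₁ ih₂ =>
    exact ⟨fun hp h => ⟨ih₁.1 hp.1 h.1, ih₂.1 hp.2 h.2⟩,
      fun hp h => ⟨ih₁.2 hp.1 h.1, ih₂.2 hp.2 h.2⟩⟩
  | or φ ψ ih₁ ih₂ =>
    exact ⟨fun hp h => h.imp (ih₁.1 hp.1) (ih₂.1 hp.2),
      fun hp h => h.imp (ih₁.2 hp.1) (ih₂.2 hp.2)⟩

theorem Problem.op_mono (P : Problem S) (M : Structure S) : Monotone (P.op M) :=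
  fun _ _ hIJ R a => (QF.holds_withDRel_mono M (fun R a => hIJ R a) a (P.body R)).1 (P.body_pos R)

/-- The relations of `M`, with the one that `L` is about restricted to the tuples satisfying
the conclusion of `L`. -/
def Lem.restrict (M : Structure S) (L : Lem S) (R : S.DRel) (a : Fin (S.dAr R) → M.carrier S.fg) :
    Prop :=
  M.drel R a ∧ ∀ h : L.R = R, L.ψ.Holds M fun i => a (Fin.cast (congrArg S.dAr h) i)

/-- This turns the syntactic replacement in `PFP` into a change of interpretation, so that `PFP(L)`
becomes a statement about `P.op M` applied to `L.restrict M`. -/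
theorem Lem.holds_strengthen {X : Type v} (M : Structure S) (L : Lem S) (e : X → M.carrier S.fg)
    (φ : QF S X) :
    (L.strengthen φ).Holds M e ↔ φ.Holds { M with drel := L.restrict M } e := by
  induction φ with
  | fls => rfl
  | eq t t' =>
    simp only [Lem.strengthen, QF.Holds]
    rw [Term.eval_withDRel M (L.restrict M), Term.eval_withDRel M (L.restrict M)]
  | rel R ts => simp only [Lem.strengthen, QF.Holds, Term.eval_withDRel M]
  | drel R ts =>
    simp only [Lem.strengthen]
    split_ifs with h
    · simp only [QF.Holds, QF.holds_subst, Term.eval_withDRel M, Lem.restrict]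
      exact ⟨fun H => ⟨H.2, fun _ => H.1⟩, fun H => ⟨H.2 h, H.1⟩⟩
    · simp only [QF.Holds, Term.eval_withDRel M, Lem.restrict]
      exact ⟨fun H => ⟨H, fun h' => absurd h' h⟩, fun H => H.1⟩
  | not φ ih => simp only [Lem.strengthen, QF.Holds, ih]
  | and φ ψ ih₁ ih₂ => simp only [Lem.strengthen, QF.Holds, ih₁, ih₂]
  | or φ ψ ih₁ ih₂ => simp only [Lem.strengthen, QF.Holds, ih₁, ih₂]

/-! ### Least fixpoint models -/

theorem Problem.LFPModel.foModel {P : Problem S} {M : Structure S} (h : P.LFPModel M) :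
    P.FOModel M := by
  refine ⟨h.1, h.2.1, fun R e => ?_⟩
  have hfix : P.op M M.drel = M.drel := h.2.2.1
  refine (QF.holds_iff M e _ _).2 (Iff.symm (iff_of_eq ?_))
  exact congrFun (congrFun hfix R) e

/-- Induction: a lemma whose `PFP` holds in a least fixpoint model holds there. -/
theorem Problem.LFPModel.holds_of_pfp {P : Problem S} {M : Structure S} (h : P.LFPModel M)
    {L : Lem S} (hL : (P.pfp L).Holds M) : L.sent.Holds M := by
  have hfix : P.op M M.drel = M.drel := h.2.2.1
  let f : ((R : S.DRel) → (Fin (S.dAr R) → M.carrier S.fg) → Prop) →o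
      ((R : S.DRel) → (Fin (S.dAr R) → M.carrier S.fg) → Prop) := ⟨P.op M, P.op_mono M⟩
  -- `LFPModel` only asserts leastness among fixed points; by Knaster–Tarski the least fixed point
  -- also lies below every pre-fixed point.
  have hle : M.drel ≤ f.lfp := h.2.2.2 f.map_lfp
  -- The restriction is a pre-fixed point: monotonicity keeps the image inside `M.drel`, and
  -- `PFP(L)` supplies the conclusion of `L`.
  have hpre : P.op M (L.restrict M) ≤ L.restrict M := by
    intro R a ha
    refine ⟨?_, ?_⟩
    · have h1 : P.op M (L.restrict M) R a ≤ P.op M M.drel R a :=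
        P.op_mono M (fun _ _ h => h.1) R a
      rw [hfix] at h1
      exact h1 ha
    · rintro rfl
      exact (QF.holds_imp M a _ _).1 (hL a) ((L.holds_strengthen M a _).2 ha)
  have hres : M.drel ≤ L.restrict M := hle.trans (f.lfp_le hpre)
  intro e
  exact (L.holds_sent_mat M e).2 fun he => (hres L.R e he).2 rfl

/-- Ensures that constraint (c) never excludes a lemma of the given sequence. -/
theorem Problem.InductiveSeq.holds_of_lfpModel {P : Problem S} {Ls : List (Lem S)}
    (hLs : P.InductiveSeq Ls) {M : Structure S} (hM : P.LFPModel M) :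
    ∀ L ∈ Ls, L.sent.Holds M := by
  have key : ∀ n (hn : n < Ls.length), (Ls.get ⟨n, hn⟩).sent.Holds M := by
    intro n
    induction n using Nat.strong_induction_on with
    | _ n ih =>
      intro hn
      exact hM.holds_of_pfp (hLs ⟨n, hn⟩ M hM.foModel fun j hj => ih j hj j.2)
  intro L hL
  obtain ⟨i, rfl⟩ := List.get_of_mem hL
  exact key i i.2

/-! ### Ultraproducts -/

section Ultraproduct

variable (F : Ultrafilter ℕ) (Ms : ℕ → Structure S)

/-- The ultraproduct of a sequence of structures. -/
noncomputable def ultraproduct : Structure S where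
  carrier σ := (F : Filter ℕ).Product fun k => (Ms k).carrier σ
  nonempty σ := ⟨Quotient.mk _ fun k => Classical.choice ((Ms k).nonempty σ)⟩
  fn f a := Quotient.mk _ fun k => (Ms k).fn f fun i => (a i).out k
  rel R a := ∀ᶠ k in (F : Filter ℕ), (Ms k).rel R fun i => (a i).out k
  drel R a := ∀ᶠ k in (F : Filter ℕ), (Ms k).drel R fun i => (a i).out k

/-- The element of the ultraproduct that is given by a sequence of elements. -/
def ultraproduct.mk {σ : S.Srt} (a : ∀ k, (Ms k).carrier σ) : (ultraproduct F Ms).carrier σ :=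
  Quotient.mk ((F : Filter ℕ).productSetoid fun k => (Ms k).carrier σ) a

/-- A sequence that represents an element of the ultraproduct. -/
noncomputable def ultraproduct.out {σ : S.Srt} (a : (ultraproduct F Ms).carrier σ) :
    ∀ k, (Ms k).carrier σ :=
  Quotient.out (s := (F : Filter ℕ).productSetoid fun k => (Ms k).carrier σ) a

theorem ultraproduct.mk_out {σ : S.Srt} (a : (ultraproduct F Ms).carrier σ) :
    mk F Ms (out F Ms a) = a :=
  Quotient.out_eq (s := (F : Filter ℕ).productSetoid fun k => (Ms k).carrier σ) a

theorem ultraproduct.mk_eq_mk {σ : S.Srt} {a b : ∀ k, (Ms k).carrier σ} :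
    mk F Ms a = mk F Ms b ↔ ∀ᶠ k in (F : Filter ℕ), a k = b k :=
  Quotient.eq (r := (F : Filter ℕ).productSetoid fun k => (Ms k).carrier σ)

theorem ultraproduct.out_mk {σ : S.Srt} (a : ∀ k, (Ms k).carrier σ) :
    ∀ᶠ k in (F : Filter ℕ), out F Ms (mk F Ms a) k = a k :=
  (mk_eq_mk F Ms).1 (mk_out F Ms _)

theorem ultraproduct.eval_mk {V : S.Srt → Type v} (e : ∀ k σ, V σ → (Ms k).carrier σ)
    {σ : S.Srt} (t : Term S V σ) :
    t.eval (ultraproduct F Ms) (fun τ x => mk F Ms fun k => e k τ x) =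
      mk F Ms fun k => t.eval (Ms k) (e k) := by
  induction t with
  | var x => rfl
  | app f ts ih =>
    refine (mk_eq_mk F Ms).2 ?_
    have h := Filter.eventually_all.2 fun i => out_mk F Ms fun k => (ts i).eval (Ms k) (e k)
    filter_upwards [h] with k hk
    simp only [Term.eval]
    congr 1
    funext i
    rw [ih i]
    exact hk i

/-- The ultraproduct interprets symbols through chosen representatives. Arities are finite, so the
choices for all arguments are simultaneously correct on a set of the ultrafilter. -/
theorem ultraproduct.eventually_out {n : ℕ} {σ : Fin n → S.Srt}
    (p : ∀ k, (∀ i, (Ms k).carrier (σ i)) → Prop) (a : ∀ i k, (Ms k).carrier (σ i)) :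
    (∀ᶠ k in (F : Filter ℕ), p k fun i => out F Ms (mk F Ms (a i)) k) ↔
      ∀ᶠ k in (F : Filter ℕ), p k fun i => a i k := by
  have h := Filter.eventually_all.2 fun i => out_mk F Ms (a i)
  refine Filter.eventually_congr (h.mono fun k hk => ?_)
  rw [show (fun i => out F Ms (mk F Ms (a i)) k) = fun i => a i k from funext hk]

/-- Łoś's theorem for background formulas. -/
theorem ultraproduct.bform_holds_mk (φ : BForm S) (e : ∀ k σ, ℕ → (Ms k).carrier σ) :
    φ.Holds (ultraproduct F Ms) (fun τ x => mk F Ms fun k => e k τ x) ↔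
      ∀ᶠ k in (F : Filter ℕ), φ.Holds (Ms k) (e k) := by
  induction φ generalizing e with
  | fls => simp [BForm.Holds, F.neBot.ne]
  | eq t s =>
    simp only [BForm.Holds]
    rw [eval_mk, eval_mk, mk_eq_mk]
  | rel R ts =>
    simp only [BForm.Holds, eval_mk]
    exact eventually_out F Ms (fun k => (Ms k).rel R) fun i k => (ts i).eval (Ms k) (e k)
  | imp φ ψ ih₁ ih₂ =>
    simp only [BForm.Holds, ih₁, ih₂]
    exact Ultrafilter.eventually_imp.symm
  | all σ n φ ih =>
    constructor
    · intro h
      by_contra hne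
      have hne' := Ultrafilter.eventually_not.2 hne
      -- At indices where the universal formula fails, `e'` is a refuting assignment; elsewhere `e
      -- k` itself serves as a default.
      have hex : ∀ k, ∃ e' : ∀ τ, ℕ → (Ms k).carrier τ,
          (∀ τ m, ¬ (τ = σ ∧ m = n) → e' τ m = e k τ m) ∧
            (¬ (BForm.all σ n φ).Holds (Ms k) (e k) → ¬ φ.Holds (Ms k) e') := by
        intro k
        by_cases hk : (BForm.all σ n φ).Holds (Ms k) (e k)
        · exact ⟨e k, fun _ _ _ => rfl, fun h' => absurd hk h'⟩
        · have hk' := hk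
          simp only [BForm.Holds, not_forall] at hk'
          obtain ⟨e', he', hn⟩ := hk'
          exact ⟨e', he', fun _ => hn⟩
      choose e' he' hn using hex
      have h1 := (ih e').1 (h _ fun τ m hτ => by
        simp only [he' _ τ m hτ])
      obtain ⟨k, hk1, hk2⟩ := (h1.and hne').exists
      exact hn k hk2 hk1
    · intro h e' he'
      classical
      let e'' : ∀ k τ, ℕ → (Ms k).carrier τ := fun k τ m =>
        if τ = σ ∧ m = n then out F Ms (e' τ m) k else e k τ m
      have hmk : e' = fun τ m => mk F Ms fun k => e'' k τ m := by
        funext τ m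
        by_cases hτ : τ = σ ∧ m = n
        · simp only [e'', if_pos hτ]
          exact (mk_out F Ms _).symm
        · simp only [e'', if_neg hτ]
          exact he' τ m hτ
      rw [hmk, ih e'']
      filter_upwards [h] with k hk
      exact hk _ fun τ m hτ => by simp only [e'', if_neg hτ]

theorem ultraproduct.lift_mk {X : Type v} (e : ∀ k, X → (Ms k).carrier S.fg) :
    FgOnly.lift (C := (ultraproduct F Ms).carrier) (fun x => mk F Ms fun k => e k x) =
      fun τ x => mk F Ms fun k => FgOnly.lift (C := (Ms k).carrier) (e k) τ x := by
  funext τ x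
  cases x
  rfl

theorem ultraproduct.qf_holds_mk {X : Type v} (φ : QF S X) (e : ∀ k, X → (Ms k).carrier S.fg) :
    φ.Holds (ultraproduct F Ms) (fun x => mk F Ms fun k => e k x) ↔
      ∀ᶠ k in (F : Filter ℕ), φ.Holds (Ms k) (e k) := by
  induction φ with
  | fls => simp [QF.Holds, F.neBot.ne]
  | eq t s =>
    simp only [QF.Holds, lift_mk]
    rw [eval_mk, eval_mk, mk_eq_mk]
  | rel R ts =>
    simp only [QF.Holds, lift_mk, eval_mk]
    exact eventually_out F Ms (fun k => (Ms k).rel R)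
      fun i k => (ts i).eval (Ms k) (FgOnly.lift (e k))
  | drel R ts =>
    simp only [QF.Holds, lift_mk, eval_mk]
    exact eventually_out F Ms (σ := fun _ => S.fg) (fun k => (Ms k).drel R)
      fun i k => (ts i).eval (Ms k) (FgOnly.lift (e k))
  | not φ ih =>
    simp only [QF.Holds, ih]
    exact Ultrafilter.eventually_not.symm
  | and φ ψ ih₁ ih₂ =>
    simp only [QF.Holds, ih₁, ih₂]
    exact Filter.eventually_and.symm
  | or φ ψ ih₁ ih₂ =>
    simp only [QF.Holds, ih₁, ih₂]
    exact Ultrafilter.eventually_or.symm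

theorem ultraproduct.background {P : Problem S} (h : ∀ k, P.Background (Ms k)) :
    P.Background (ultraproduct F Ms) := by
  intro φ hφ e
  have he : e = fun τ m => mk F Ms fun k => out F Ms (e τ m) k := by
    funext τ m
    exact (mk_out F Ms _).symm
  rw [he]
  exact (bform_holds_mk F Ms φ fun k τ m => out F Ms (e τ m) k).2
    (Filter.Eventually.of_forall fun k => h k φ hφ _)

end Ultraproduct

/-! ### Restricting the foreground carrier -/

section Hull

variable (M : Structure S) (H : ∀ σ, Set (M.carrier σ)) (hne : (H S.fg).Nonempty)

open Classical in
/-- The structure with foreground carrier `H S.fg` and the background carriers of `M`. Values of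
functions that lie outside are replaced by arbitrary ones. -/
noncomputable def hull : Structure S where
  carrier σ := {a : M.carrier σ // σ = S.fg → a ∈ H σ}
  nonempty σ := by
    by_cases h : σ = S.fg
    · subst h
      exact ⟨⟨hne.some, fun _ => hne.some_mem⟩⟩
    · exact (M.nonempty σ).map fun a => ⟨a, fun h' => absurd h' h⟩
  fn f a :=
    if h : S.fnCod f = S.fg → M.fn f (fun i => (a i).1) ∈ H (S.fnCod f) then ⟨_, h⟩
    else Classical.choice (by
      push Not at h
      rw [h.1]
      exact ⟨⟨hne.some, fun _ => hne.some_mem⟩⟩)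
  rel R a := M.rel R fun i => (a i).1
  drel R a := M.drel R fun i => (a i).1

/-- The inclusion of the carriers. -/
def hull.val {σ : S.Srt} (a : (hull M H hne).carrier σ) : M.carrier σ := a.1

/-- An element of `M` as an element of the hull. -/
def hull.mk {σ : S.Srt} (a : M.carrier σ) (ha : σ = S.fg → a ∈ H σ) :
    (hull M H hne).carrier σ := ⟨a, ha⟩

theorem hull.val_injective {σ : S.Srt} : Function.Injective (val M H hne (σ := σ)) :=
  Subtype.val_injective

theorem hull.val_fn (f : S.Fn) (a : ∀ i, (hull M H hne).carrier (S.fnDom f i))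
    (h : S.fnCod f = S.fg → M.fn f (fun i => val M H hne (a i)) ∈ H (S.fnCod f)) :
    val M H hne ((hull M H hne).fn f a) = M.fn f fun i => val M H hne (a i) :=
  congrArg Subtype.val (dif_pos h)

theorem hull.val_eval_background {V : S.Srt → Type v} (e : ∀ σ, V σ → (hull M H hne).carrier σ)
    {σ : S.Srt} (t : Term S V σ) (ht : t.IsBackground) :
    val M H hne (t.eval (hull M H hne) e) = t.eval M fun τ x => val M H hne (e τ x) := by
  induction t with
  | var x => rfl
  | app f ts ih =>
    simp only [Term.eval]
    rw [val_fn M H hne _ _ fun h => absurd h ht.1]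
    congr 1
    funext i
    exact ih i (ht.2.2 i)

/-- Background carriers are unchanged, and functions with background values never take the arbitrary
default, so background formulas do not notice the restriction. -/
theorem hull.bform_holds (φ : BForm S) (hφ : φ.IsBackground)
    (e : ∀ σ, ℕ → (hull M H hne).carrier σ) :
    φ.Holds (hull M H hne) e ↔ φ.Holds M fun τ x => val M H hne (e τ x) := by
  induction φ generalizing e with
  | fls => rfl
  | eq t s =>
    simp only [BForm.Holds]
    rw [← val_eval_background M H hne e t hφ.1, ← val_eval_background M H hne e s hφ.2,
      (val_injective M H hne).eq_iff]
  | rel R ts =>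
    simp only [BForm.Holds, ← fun i => val_eval_background M H hne e (ts i) (hφ.2 i)]
    rfl
  | imp φ ψ ih₁ ih₂ => simp only [BForm.Holds, ih₁ hφ.1, ih₂ hφ.2]
  | all σ n φ ih =>
    constructor
    · intro h e' he'
      classical
      let e'' : ∀ τ, ℕ → (hull M H hne).carrier τ := fun τ m =>
        if hτ : τ = σ ∧ m = n then
          mk M H hne (e' τ m) fun h' => absurd (hτ.1.symm.trans h') hφ.1
        else e τ m
      have hval : e' = fun τ m => val M H hne (e'' τ m) := by
        funext τ m
        by_cases hτ : τ = σ ∧ m = n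
        · simp only [e'', dif_pos hτ]
          rfl
        · simp only [e'', dif_neg hτ]
          exact he' τ m hτ
      rw [hval, ← ih hφ.2]
      exact h _ fun τ m hτ => by simp only [e'', dif_neg hτ]
    · intro h e' he'
      rw [ih hφ.2]
      exact h _ fun τ m hτ => by rw [he' τ m hτ]

theorem hull.background {P : Problem S} (h : P.Background M) : P.Background (hull M H hne) :=
  fun φ hφ e => (bform_holds M H hne φ (P.T_background φ hφ) e).2 (h φ hφ _)

/-- Membership in `H` is proved along with the equation and at all sorts: a foreground term may have
background subterms, and `hcl` controls a function only at arguments from `H`. The hull keeps all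
background elements, so elsewhere its functions may take default values, but evaluating these terms
never meets them. -/
theorem hull.val_eval {X : Type v}
    (hcl : ∀ (f : S.Fn) (a : ∀ i, M.carrier (S.fnDom f i)), (∀ i, a i ∈ H _) → M.fn f a ∈ H _)
    (e : X → (hull M H hne).carrier S.fg) {σ : S.Srt}
    (t : Term S (FgOnly S X) σ) :
    val M H hne (t.eval (hull M H hne) (FgOnly.lift e)) =
        t.eval M (FgOnly.lift fun x => val M H hne (e x)) ∧
      t.eval M (FgOnly.lift fun x => val M H hne (e x)) ∈ H σ := by
  induction t with
  | var x =>
    cases x with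
    | mk x => exact ⟨rfl, (e x).2 rfl⟩
  | app f ts ih =>
    have harg : (fun i => val M H hne ((ts i).eval (hull M H hne) (FgOnly.lift e))) =
        fun i => (ts i).eval M (FgOnly.lift fun x => val M H hne (e x)) :=
      funext fun i => (ih i).1
    have hmem := hcl f _ fun i => (ih i).2
    refine ⟨?_, hmem⟩
    simp only [Term.eval]
    rw [val_fn M H hne _ _ fun _ => by rw [harg]; exact hmem, harg]

theorem hull.qf_holds {X : Type v}
    (hcl : ∀ (f : S.Fn) (a : ∀ i, M.carrier (S.fnDom f i)), (∀ i, a i ∈ H _) → M.fn f a ∈ H _)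
    (φ : QF S X) (e : X → (hull M H hne).carrier S.fg) :
    φ.Holds (hull M H hne) e ↔ φ.Holds M fun x => val M H hne (e x) := by
  have hev : ∀ {σ : S.Srt} (t : Term S (FgOnly S X) σ),
      t.eval M (FgOnly.lift fun x => val M H hne (e x)) =
        val M H hne (t.eval (hull M H hne) (FgOnly.lift e)) :=
    fun t => (val_eval M H hne hcl e t).1.symm
  induction φ with
  | fls => rfl
  | eq t s =>
    simp only [QF.Holds]
    rw [hev, hev, (val_injective M H hne).eq_iff]
  | rel R ts => simp only [QF.Holds, hev]; rfl
  | drel R ts => simp only [QF.Holds, hev]; rfl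
  | not φ ih => simp only [QF.Holds, ih]
  | and φ ψ ih₁ ih₂ => simp only [QF.Holds, ih₁, ih₂]
  | or φ ψ ih₁ ih₂ => simp only [QF.Holds, ih₁, ih₂]

end Hull

/-! ### Completeness of instantiation with ground terms of bounded depth -/

/-- The instances of `φ` by tuples from `U` hold in `M`. -/
def USent.HoldsOn (M : Structure S) (U : Set (M.carrier S.fg)) (φ : USent S) : Prop :=
  ∀ e : Fin φ.n → M.carrier S.fg, (∀ i, e i ∈ U) → φ.mat.Holds M e

/-- The values of the ground terms of depth at most `k`. -/
def CStructure.vals {X : Type v} (N : CStructure S X) (k : ℕ) : Set (N.M.carrier S.fg) :=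
  {a | ∃ t ∈ groundTerms S X k, a = t.eval N.M (FgOnly.lift N.const)}

theorem CStructure.vals_mono {X : Type v} (N : CStructure S X) : Monotone N.vals :=
  fun _ _ hkl _ ⟨t, ht, ha⟩ => ⟨t, le_trans (show t.depth ≤ _ from ht) hkl, ha⟩

/-- Lets a depth found for a fixed set of constants be used in the growing signatures of the
algorithm. -/
theorem CStructure.vals_comp_subset {X : Type v} {Y : Type w} (N : CStructure S Y) (g : X → Y)
    (k : ℕ) : (CStructure.mk N.M fun x => N.const (g x)).vals k ⊆ N.vals k := by
  rintro a ⟨t, ht, rfl⟩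
  refine ⟨t.subst (FgOnly.lift fun x => FTerm.sym (g x)), ?_, ?_⟩
  · exact (Term.depth_rename g t).trans_le ht
  · rw [Term.eval_subst, FgOnly.eval_lift]
    rfl

/-- If all instances of `Γ` by ground terms hold, so does a ground consequence of `Γ`. -/
theorem Problem.holds_of_ground_instances (P : Problem S) (Γ : Set (USent S)) {X : Type v}
    (hX : Nonempty (FTerm S X)) (θ : QF S X)
    (h : ∀ M : Structure S, P.Background M → (∀ φ ∈ Γ, φ.Holds M) → ∀ c, θ.Holds M c)
    (N : CStructure S X) (hN : P.Background N.M)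
    (hΓ : ∀ φ ∈ Γ, ∀ t : Fin φ.n → FTerm S X,
      φ.mat.Holds N.M fun i => (t i).eval N.M (FgOnly.lift N.const)) :
    θ.Holds N.M N.const := by
  let H : ∀ σ, Set (N.M.carrier σ) := fun σ =>
    Set.range fun t : Term S (FgOnly S X) σ => t.eval N.M (FgOnly.lift N.const)
  have hne : (H S.fg).Nonempty := ⟨_, hX.some, rfl⟩
  have hcl : ∀ (f : S.Fn) (a : ∀ i, N.M.carrier (S.fnDom f i)), (∀ i, a i ∈ H _) →
      N.M.fn f a ∈ H _ := by
    intro f a ha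
    choose t ht using ha
    refine ⟨.app f t, ?_⟩
    simp only [Term.eval]
    congr 1
    funext i
    exact ht i
  have hconst : ∀ x, N.const x ∈ H S.fg := fun x => ⟨FTerm.sym x, rfl⟩
  refine (hull.qf_holds N.M H hne hcl θ fun x => ⟨N.const x, fun _ => hconst x⟩).1
    (h _ (hull.background N.M H hne hN) ?_ _)
  intro φ hφ e
  refine (hull.qf_holds N.M H hne hcl φ.mat e).2 ?_
  -- Every foreground element of the hull is the value of a ground term, so each instance of a
  -- universal sentence is a ground instance.
  choose t ht using fun i => (e i).2 rfl
  have := hΓ φ hφ t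
  rwa [show (fun i => (t i).eval N.M (FgOnly.lift N.const)) =
    fun i => hull.val N.M H hne (e i) from funext ht] at this

/-- A ground consequence of `Γ` follows from the instances of `Γ` by ground terms of some bounded
depth. -/
theorem Problem.exists_depth (P : Problem S) (Γ : Set (USent S)) {X : Type v}
    (hX : Nonempty (FTerm S X)) (θ : QF S X)
    (h : ∀ M : Structure S, P.Background M → (∀ φ ∈ Γ, φ.Holds M) → ∀ c, θ.Holds M c) :
    ∃ k, ∀ N : CStructure S X, P.Background N.M → (∀ φ ∈ Γ, φ.HoldsOn N.M (N.vals k)) →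
      θ.Holds N.M N.const := by
  by_contra hcon
  push Not at hcon
  choose N hB hΓ hθ using hcon
  -- `N k` satisfies the instances of depth at most `k` but refutes `θ`. A non-principal ultrafilter
  -- makes every fixed instance hold in the ultraproduct, since its terms have depth at most `k` for
  -- all large `k`.
  let F : Ultrafilter ℕ := Filter.hyperfilter ℕ
  let Ms : ℕ → Structure S := fun k => (N k).M
  let N' : CStructure S X :=
    ⟨ultraproduct F Ms, fun x => ultraproduct.mk F Ms fun k => (N k).const x⟩
  have hθ' : θ.Holds N'.M N'.const := by
    refine P.holds_of_ground_instances Γ hX θ h N' (ultraproduct.background F Ms hB) ?_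
    intro φ hφ t
    have hev : (fun i => (t i).eval N'.M (FgOnly.lift N'.const)) = fun i =>
        ultraproduct.mk F Ms fun k => (t i).eval (Ms k) (FgOnly.lift (N k).const) := by
      funext i
      exact (congrArg (fun e => (t i).eval N'.M e)
        (ultraproduct.lift_mk F Ms fun k => (N k).const)).trans
          (ultraproduct.eval_mk F Ms (fun k => FgOnly.lift (N k).const) (t i))
    rw [hev]
    refine (ultraproduct.qf_holds_mk F Ms φ.mat
      fun k i => (t i).eval (Ms k) (FgOnly.lift (N k).const)).2 ?_
    have hle : ∀ᶠ k in (F : Filter ℕ), Finset.univ.sup (fun i => (t i).depth) ≤ k :=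
      Nat.hyperfilter_le_atTop (Filter.eventually_ge_atTop _)
    filter_upwards [hle] with k hk
    exact hΓ k φ hφ _ fun i =>
      ⟨t i, (Finset.le_sup (f := fun i => (t i).depth) (Finset.mem_univ i)).trans hk, rfl⟩
  obtain ⟨k, hk⟩ := ((ultraproduct.qf_holds_mk F Ms θ fun k => (N k).const).1 hθ').exists
  exact hθ k hk

/-! ### Ground models and instances -/

theorem USent.over_holds {X : Type v} (φ : USent S) (M : Structure S) (c : X → M.carrier S.fg)
    (e : Fin φ.n → M.carrier S.fg) :
    (φ.over X).mat.Holds M (Sum.elim c e) ↔ φ.mat.Holds M e :=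
  QF.holds_subst M _ _ _

theorem USent.negAt_holds {X : Type v} (φ : USent S) (d : Fin φ.n → X) (M : Structure S)
    (c : X → M.carrier S.fg) (e : Fin 0 → M.carrier S.fg) :
    (φ.negAt d).mat.Holds M (Sum.elim c e) ↔ ¬ φ.mat.Holds M fun i => c (d i) :=
  not_congr (QF.holds_subst M _ _ _)

theorem Problem.ip_holds {X : Type v} (P : Problem S) (L : Lem S) (d : Fin (S.dAr L.R) → X)
    (M : Structure S) (c : X → M.carrier S.fg) (e : Fin (S.dAr L.R) → M.carrier S.fg) :
    (P.ip L d).mat.Holds M (Sum.elim c e) ↔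
      ((P.pfp L).mat.Holds M (fun i => c (d i)) → L.sent.mat.Holds M e) := by
  refine Iff.trans (or_congr (not_congr (QF.holds_subst M _ _ _)) (QF.holds_subst M _ _ _))
    imp_iff_not_or.symm

theorem Problem.GroundModel.holds {X : Type v} {P : Problem S} {N : CStructure S X}
    {Φ : Set (UForm S X)} {k : ℕ} (hN : P.GroundModel N (instances Φ k)) {φ : UForm S X}
    (hφ : φ ∈ Φ) (e : Fin φ.n → N.M.carrier S.fg) (he : ∀ i, e i ∈ N.vals k) :
    φ.mat.Holds N.M (Sum.elim N.const e) := by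
  choose t ht hte using he
  have h := hN.2 _ ⟨φ, hφ, t, ht, rfl⟩
  rw [QF.holds_subst] at h
  convert h using 1
  funext x
  cases x with
  | inl x => rfl
  | inr i => exact hte i

theorem Problem.groundModel_of_holds {X : Type v} {P : Problem S} {M : Structure S}
    (hM : P.Background M) {c : X → M.carrier S.fg} {Φ : Set (UForm S X)} (k : ℕ)
    (h : ∀ φ ∈ Φ, ∀ e : Fin φ.n → M.carrier S.fg, φ.mat.Holds M (Sum.elim c e)) :
    P.GroundModel ⟨M, c⟩ (instances Φ k) := by
  refine ⟨hM, ?_⟩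
  rintro η ⟨φ, hφ, t, -, rfl⟩
  rw [QF.holds_subst]
  convert h φ hφ fun i => (t i).eval M (FgOnly.lift c) using 1
  funext x
  cases x <;> rfl

/-- The axioms together with the first-order readings of the recursive definitions. -/
def Problem.base (P : Problem S) : Set (USent S) := P.A ∪ Set.range P.defSent

theorem Problem.foModel_iff {P : Problem S} {M : Structure S} :
    P.FOModel M ↔ P.Background M ∧ ∀ φ ∈ P.base, φ.Holds M := by
  refine and_congr_right fun _ => ⟨?_, fun h => ⟨fun φ hφ => h φ (.inl hφ),
    fun R => h _ (.inr ⟨R, rfl⟩)⟩⟩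
  rintro ⟨hA, hD⟩ φ (hφ | ⟨R, rfl⟩)
  exacts [hA φ hφ, hD R]

section Counterexample

variable {P : Problem S} {k : ℕ} {s : State S} {N : CStructure S (P.Sk s)}

theorem Problem.Counterexample.holdsOn_base (hN : P.Counterexample k s N) {φ : USent S}
    (hφ : φ ∈ P.base) : φ.HoldsOn N.M (N.vals k) := fun e he =>
  (φ.over_holds N.M N.const e).1 <| hN.holds (φ := φ.over _)
    (by
      obtain hφ | ⟨R, rfl⟩ := hφ
      · exact .inl (.inl (.inl (.inl ⟨φ, hφ, rfl⟩)))
      · exact .inl (.inl (.inl (.inr ⟨R, rfl⟩)))) e he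

theorem Problem.Counterexample.holdsOn_lemma (hN : P.Counterexample k s N) {L : Lem S}
    (hL : L ∈ s.lemmas) : L.sent.HoldsOn N.M (N.vals k) := fun e he =>
  (L.sent.over_holds N.M N.const e).1 <| hN.holds (φ := L.sent.over _)
    (.inl (.inl (.inr ⟨L, hL, rfl⟩))) e he

theorem Problem.Counterexample.holdsOn_of_pfp (hN : P.Counterexample k s N)
    (i : Fin s.ips.length)
    (hi : (P.pfp (s.ips.get i)).mat.Holds N.M fun j => N.const (Sum.inr ⟨i, j⟩)) :
    (s.ips.get i).sent.HoldsOn N.M (N.vals k) := fun e he =>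
  (P.ip_holds (X := P.Sk s) (s.ips.get i) (fun j => Sum.inr ⟨i, j⟩) N.M N.const e).1
    (hN.holds (φ := P.ip (s.ips.get i) fun j => Sum.inr ⟨i, j⟩) (.inl (.inr ⟨i, rfl⟩)) e he) hi

theorem Problem.Counterexample.not_holds_target (hN : P.Counterexample k s N) :
    ¬ P.α.mat.Holds N.M fun i => N.const (Sum.inl i) :=
  (P.α.negAt_holds (X := P.Sk s) Sum.inl N.M N.const Fin.elim0).1
    (hN.holds (φ := P.α.negAt Sum.inl) (.inr rfl) _ fun i => i.elim0)

theorem Problem.Candidate.not_mem_lemmas {G : Set (Structure S)} {L : Lem S}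
    (h : P.Candidate k G s N L) (hN : P.Counterexample k s N) : L ∉ s.lemmas := by
  obtain ⟨⟨a, ha, hna⟩, -, -⟩ := h
  exact fun hL => hna (hN.holdsOn_lemma hL a ha)

/-- Constraint (b) includes the Skolem tuple introduced for `L` itself; there the instances of
`IP(L, c̄_L)` force `L` to hold on `U_k`, against (a). -/
theorem Problem.Candidate.not_mem_ips {G : Set (Structure S)} {L : Lem S}
    (h : P.Candidate k G s N L) (hN : P.Counterexample k s N) : L ∉ s.ips := by
  obtain ⟨⟨a, ha, hna⟩, hpfp, -⟩ := h
  intro hL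
  obtain ⟨i, rfl⟩ := List.get_of_mem hL
  exact hna (hN.holdsOn_of_pfp i (hpfp i rfl) a ha)

end Counterexample

/-! ### A depth at which a candidate always exists -/

/-- A first-order consequence of `A ∪ D ∪ Γ` holds at all tuples of constants in every structure in
which the instances of `A ∪ D ∪ Γ` by ground terms of some bounded depth hold. -/
theorem Problem.exists_depth_consequence (P : Problem S) (hground : Nonempty (FTerm S (Fin P.α.n)))
    (Γ : Set (USent S)) (χ : USent S)
    (h : ∀ M : Structure S, P.FOModel M → (∀ φ ∈ Γ, φ.Holds M) → χ.Holds M) :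
    ∃ k₀, ∀ k ≥ k₀, ∀ (s : State S) (N : CStructure S (P.Sk s)), P.Counterexample k s N →
      (∀ φ ∈ Γ, φ.HoldsOn N.M (N.vals k)) →
      ∀ c : Fin χ.n → P.Sk s, χ.mat.Holds N.M fun i => N.const (c i) := by
  -- The constants are one tuple for the variables of `χ` and those of `¬ α`; the latter guarantee a
  -- ground term even when `χ` has no variables. This set does not depend on the state, and
  -- therefore neither does `k₀`.
  have hX : Nonempty (FTerm S (Fin χ.n ⊕ Fin P.α.n)) :=
    hground.map fun t => t.subst (FgOnly.lift fun x => FTerm.sym (Sum.inr x))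
  obtain ⟨k₀, hk₀⟩ := P.exists_depth (P.base ∪ Γ) hX
    (χ.mat.subst fun i => FTerm.sym (Sum.inl i)) (by
      intro M hM hΓ c
      rw [QF.holds_subst]
      exact h M (P.foModel_iff.2 ⟨hM, fun φ hφ => hΓ φ (.inl hφ)⟩)
        (fun φ hφ => hΓ φ (.inr hφ)) _)
  refine ⟨k₀, fun k hk s N hN hΓ c => ?_⟩
  let g : Fin χ.n ⊕ Fin P.α.n → P.Sk s := Sum.elim c Sum.inl
  have hsub : (CStructure.mk N.M fun x => N.const (g x)).vals k₀ ⊆ N.vals k :=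
    (N.vals_comp_subset g k₀).trans (N.vals_mono hk)
  have hθ := hk₀ ⟨N.M, fun x => N.const (g x)⟩ hN.1 (by
    rintro φ (hφ | hφ) e he
    · exact hN.holdsOn_base hφ e fun i => hsub (he i)
    · exact hΓ φ hφ e fun i => hsub (he i))
  rw [QF.holds_subst] at hθ
  exact hθ

/-- The heart of the argument: the first lemma of the sequence that fails on `U_k` is a candidate,
and one must fail because `α` does. -/
theorem Problem.exists_depth_candidate (P : Problem S)
    (hground : Nonempty (FTerm S (Fin P.α.n))) {Ls : List (Lem S)} (hLs : P.InductiveSeq Ls)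
    (hα : ∀ M : Structure S, P.FOModel M → (∀ L ∈ Ls, L.sent.Holds M) → P.α.Holds M) :
    ∃ k, ∀ G : Set (Structure S), (∀ M ∈ G, P.LFPModel M) →
      ∀ (s : State S) (N : CStructure S (P.Sk s)), P.Counterexample k s N →
        ∃ L ∈ Ls, P.Candidate k G s N L := by
  obtain ⟨kα, hkα⟩ := P.exists_depth_consequence hground (Lem.sent '' {L | L ∈ Ls}) P.α
    fun M hM hΓ => hα M hM fun L hL => hΓ _ ⟨L, hL, rfl⟩
  have hpfp := fun i : Fin Ls.length => P.exists_depth_consequence hground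
    ((fun j => (Ls.get j).sent) '' {j | j < i}) (P.pfp (Ls.get i))
    fun M hM hΓ => hLs i M hM fun j hj => hΓ _ ⟨j, hj, rfl⟩
  choose K hK using hpfp
  refine ⟨max kα (Finset.univ.sup K), fun G hG s N hN => ?_⟩
  by_contra hcon
  push Not at hcon
  have hall : ∀ i : Fin Ls.length, (Ls.get i).sent.HoldsOn N.M
      (N.vals (max kα (Finset.univ.sup K))) := by
    intro i
    induction i using WellFoundedLT.induction with
    | _ i ih =>
      by_contra hi
      simp only [USent.HoldsOn, not_forall] at hi
      obtain ⟨a, ha, hna⟩ := hi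
      refine hcon _ (List.get_mem Ls i) ⟨⟨a, ha, hna⟩, fun j hj => ?_,
        fun M hM => hLs.holds_of_lfpModel (hG M hM) _ (List.get_mem Ls i)⟩
      -- Constraint (b): all earlier lemmas hold on `U_k`, so `PFP` of the current one holds at
      -- every tuple of constants, in particular at the Skolem tuples in use.
      refine hK i _ ((Finset.le_sup (Finset.mem_univ i)).trans (le_max_right _ _)) s N hN ?_ _
      rintro _ ⟨j, hj, rfl⟩
      exact ih j hj
  refine hN.not_holds_target (hkα _ (le_max_left _ _) s N hN ?_ _)
  rintro _ ⟨L, hL, rfl⟩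
  obtain ⟨i, rfl⟩ := List.get_of_mem hL
  exact hall i

/-! ### Soundness -/

theorem Problem.holds_pfp_of_not_sat {P : Problem S} {k : ℕ} {s : State S} {L : Lem S}
    (h : ¬ P.SAT (instances (P.ΦL s L) k)) {M : Structure S} (hM : P.FOModel M)
    (hs : ∀ L' ∈ s.lemmas, L'.sent.Holds M) : (P.pfp L).Holds M := by
  intro c
  by_contra hc
  refine h ⟨⟨M, c⟩, P.groundModel_of_holds hM.1 k ?_⟩
  rintro φ (((⟨χ, hχ, rfl⟩ | ⟨R, rfl⟩) | ⟨L', hL', rfl⟩) | rfl) e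
  · exact (χ.over_holds M c e).2 (hM.2.1 χ hχ e)
  · exact ((P.defSent R).over_holds M c e).2 (hM.2.2 R e)
  · exact (L'.sent.over_holds M c e).2 (hs L' hL' e)
  · exact ((P.pfp L).negAt_holds _ M c e).2 hc

theorem Problem.holds_target_of_not_sat {P : Problem S} {k : ℕ} {s : State S}
    (h : ¬ P.SAT (instances (P.Φα s) k)) {M : Structure S} (hM : P.FOModel M)
    (hs : ∀ L ∈ s.lemmas, L.sent.Holds M) (hi : ∀ L ∈ s.ips, P.IPHolds M L) : P.α.Holds M := by
  intro a
  by_contra ha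
  -- Values for the Skolem constants: a tuple refuting `PFP` if there is one; otherwise any tuple,
  -- since then the induction principle yields the lemma itself.
  have hwit : ∀ i : Fin s.ips.length, ∃ c : Fin (S.dAr (s.ips.get i).R) → M.carrier S.fg,
      (P.pfp (s.ips.get i)).mat.Holds M c → (s.ips.get i).sent.Holds M := by
    intro i
    by_cases hp : (P.pfp (s.ips.get i)).Holds M
    · exact ⟨fun _ => (M.nonempty S.fg).some, fun _ => hi _ (List.get_mem s.ips i) hp⟩
    · simp only [USent.Holds, not_forall] at hp
      exact hp.imp fun c hc h' => absurd h' hc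
  choose c hc using hwit
  let d : P.Sk s → M.carrier S.fg := Sum.elim a fun x => c x.1 x.2
  refine h ⟨⟨M, d⟩, P.groundModel_of_holds hM.1 k ?_⟩
  rintro φ ((((⟨χ, hχ, rfl⟩ | ⟨R, rfl⟩) | ⟨L, hL, rfl⟩) | ⟨i, rfl⟩) | rfl) e
  · exact (χ.over_holds M d e).2 (hM.2.1 χ hχ e)
  · exact ((P.defSent R).over_holds M d e).2 (hM.2.2 R e)
  · exact (L.sent.over_holds M d e).2 (hs L hL e)
  · exact (P.ip_holds _ _ M d e).2 fun h' => hc i h' e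
  · exact (P.α.negAt_holds _ M d e).2 ha

/-- What is invariant along the runs of the algorithm: the discovered lemmas are valid in the least
fixpoint semantics, and an output proves the target. -/
def Problem.Sound (P : Problem S) : Config S → Prop
  | .running s => ∀ L ∈ s.lemmas, ∀ M : Structure S, P.LFPModel M → L.sent.Holds M
  | .output Ls Is => P.Prove Ls Is
  | .noProof => True

theorem Problem.Step.sound {P : Problem S} {k : ℕ} {G : Set (Structure S)} {sel : P.Selection}
    {c c' : Config S} (h : P.Step k G sel c c') (hc : P.Sound c) : P.Sound c' := by
  cases h with
  | done s h => exact ⟨hc, fun M hM hs hi => P.holds_target_of_not_sat h hM hs hi⟩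
  | fail => trivial
  | addIP => exact hc
  | addLemma s N hN L hL h =>
    intro L' hL' M hM
    obtain rfl | hL' := List.mem_cons.1 hL'
    · exact hM.holds_of_pfp (P.holds_pfp_of_not_sat h hM.foModel fun L hL => hc L hL M hM)
    · exact hc L' hL' M hM

theorem Problem.Reachable.sound {P : Problem S} {k : ℕ} {G : Set (Structure S)}
    {sel : P.Selection} {c : Config S} (h : P.Reachable k G sel c) : P.Sound c := by
  induction h with
  | refl => exact fun L hL => absurd hL List.not_mem_nil
  | tail _ hstep ih => exact hstep.sound ih

/-! ### Termination -/

section Termination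

variable {P : Problem S} {k : ℕ} {G : Set (Structure S)} {sel : P.Selection} {Ls : List (Lem S)}

open Classical in
/-- A bound on the number of rounds from a state if only lemmas from `B` are selected. -/
noncomputable def State.potential (B : Finset (Lem S)) (s : State S) : ℕ :=
  (B.filter (· ∉ s.lemmas)).card * (B.card + 1) + (B.filter (· ∉ s.ips)).card

theorem State.card_filter_not_mem_cons_lt [DecidableEq (Lem S)] {B : Finset (Lem S)} {L : Lem S}
    {l : List (Lem S)} (hB : L ∈ B) (hL : L ∉ l) :
    (B.filter (· ∉ L :: l)).card < (B.filter (· ∉ l)).card := by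
  refine Finset.card_lt_card (Finset.ssubset_iff_subset_ne.2 ⟨?_, fun h => ?_⟩)
  · exact Finset.monotone_filter_right B fun L' _ h h' => h (List.mem_cons_of_mem _ h')
  · have : L ∈ B.filter (· ∉ L :: l) := h ▸ Finset.mem_filter.2 ⟨hB, hL⟩
    exact (Finset.mem_filter.1 this).2 List.mem_cons_self

theorem State.potential_addIP_lt {B : Finset (Lem S)} {s : State S} {L : Lem S} (hB : L ∈ B)
    (hL : L ∉ s.ips) : State.potential B ⟨s.lemmas, L :: s.ips⟩ < s.potential B := by
  classical
  exact Nat.add_lt_add_left (card_filter_not_mem_cons_lt hB hL) _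

/-- Resetting the induction principles raises the second summand to at most `B.card`, which the
weight `B.card + 1` of one new lemma outweighs. -/
theorem State.potential_addLemma_lt {B : Finset (Lem S)} {s : State S} {L : Lem S} (hB : L ∈ B)
    (hL : L ∉ s.lemmas) : State.potential B ⟨L :: s.lemmas, []⟩ < s.potential B := by
  classical
  have h₁ := card_filter_not_mem_cons_lt hB hL
  have h₂ : (B.filter (· ∉ ([] : List (Lem S)))).card ≤ B.card := Finset.card_filter_le _ _
  have h₃ := Nat.mul_le_mul_right (B.card + 1) (Nat.succ_le_of_lt h₁)
  rw [Nat.succ_mul] at h₃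
  simp only [State.potential]
  omega

/-- Only finitely many lemmas are ever selected. -/
theorem Problem.FairSelection.exists_finset (hsel : P.FairSelection k G sel)
    (hcand : ∀ s N, P.Counterexample k s N → ∃ L ∈ Ls, P.Candidate k G s N L) :
    ∃ B : Finset (Lem S), ∀ s N, P.Reachable k G sel (.running s) → P.Counterexample k s N →
      ∀ L, sel s N L → L ∈ B := by
  have hfin : (⋃ L ∈ {L | L ∈ Ls}, insert L {L' | L' ≠ L ∧ ∃ s N,
      P.Reachable k G sel (.running s) ∧ P.Counterexample k s N ∧
      P.Candidate k G s N L ∧ sel s N L'}).Finite :=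
    (List.finite_toSet Ls).biUnion fun L _ => (hsel.fair L).insert L
  refine ⟨hfin.toFinset, fun s N hs hN L' hL' => hfin.mem_toFinset.2 ?_⟩
  -- Some `L` from the fixed list is a candidate here, so the selected lemma is `L` or one of its
  -- finitely many competitors.
  obtain ⟨L, hL, hc⟩ := hcand s N hN
  refine Set.mem_biUnion hL ?_
  by_cases h : L' = L
  · exact .inl h
  · exact .inr ⟨h, s, N, hs, hN, hc, hL'⟩

theorem Problem.Step.exists_running {c c' : Config S} (h : P.Step k G sel c c') :
    ∃ s, c = .running s := by
  cases h <;> exact ⟨_, rfl⟩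

theorem Problem.FairSelection.terminates (hsel : P.FairSelection k G sel)
    (hcand : ∀ s N, P.Counterexample k s N → ∃ L ∈ Ls, P.Candidate k G s N L) :
    P.Terminates k G sel := by
  rintro ⟨run, h0, hstep⟩
  obtain ⟨B, hB⟩ := hsel.exists_finset hcand
  have hreach : ∀ m, P.Reachable k G sel (run m) := by
    intro m
    induction m with
    | zero => rw [h0]; exact .refl
    | succ m ih => exact ih.tail (hstep m)
  have hrun : ∀ m, ∃ s, run m = .running s :=
    fun m => (hstep m).exists_running
  choose st hst using hrun
  have hdec : ∀ m, (st (m + 1)).potential B < (st m).potential B := by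
    intro m
    have hr := hreach m
    have h := hstep m
    rw [hst m] at hr h
    rw [hst (m + 1)] at h
    generalize st (m + 1) = s' at h ⊢
    generalize st m = s at h hr ⊢
    cases h with
    | addIP _ N hN L hL h =>
      exact State.potential_addIP_lt (hB s N hr hN L hL)
        ((hsel.sound s N hr hN L hL).not_mem_ips hN)
    | addLemma _ N hN L hL h =>
      exact State.potential_addLemma_lt (hB s N hr hN L hL)
        ((hsel.sound s N hr hN L hL).not_mem_lemmas hN)
  exact not_strictAnti_of_wellFoundedLT (fun m => (st m).potential B)
    (strictAnti_nat_of_succ_lt hdec)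

/-- Since a candidate exists for every counterexample, a running state always has a next round, and
`noProof` cannot be reached. -/
theorem Problem.FairSelection.returnsProof (hsel : P.FairSelection k G sel)
    (hcand : ∀ s N, P.Counterexample k s N → ∃ L ∈ Ls, P.Candidate k G s N L) :
    P.ReturnsProof k G sel := by
  intro c hc hstuck
  cases c with
  | output Ls Is => exact ⟨Ls, Is, rfl, hc.sound⟩
  | running s =>
    exfalso
    by_cases hsat : P.SAT (instances (P.Φα s) k)
    · obtain ⟨N, hN⟩ := hsat
      obtain ⟨L, -, hL⟩ := hcand s N hN
      obtain ⟨L', hL'⟩ := hsel.total s N hc hN ⟨L, hL⟩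
      by_cases h : P.SAT (instances (P.ΦL s L') k)
      · exact hstuck _ (.addIP s N hN L' hL' h)
      · exact hstuck _ (.addLemma s N hN L' hL' h)
    · exact hstuck _ (.done s hsat)
  | noProof =>
    exfalso
    obtain h | ⟨c', -, h⟩ := hc.cases_tail
    · cases h
    · cases h with
      | fail s N hN h =>
        obtain ⟨L, -, hL⟩ := hcand s N hN
        exact h L hL

end Termination

end LemmaSynth

open LemmaSynth
theorem mainTheorem2 {S : Sig.{u}} (P : Problem S)
    (hground : Nonempty (FTerm S (Fin P.α.n)))
    (hprov : P.ProvableByInductiveSeq) :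
    ∃ k : ℕ, ∀ G : Set (Structure S), (∀ M ∈ G, P.LFPModel M) →
      ∀ sel : P.Selection, P.FairSelection k G sel →
        P.Terminates k G sel ∧ P.ReturnsProof k G sel := by
  obtain ⟨Ls, hLs, hα⟩ := hprov
  obtain ⟨k, hk⟩ := P.exists_depth_candidate hground hLs hα
  exact ⟨k, fun G hG sel hsel => ⟨hsel.terminates (hk G hG), hsel.returnsProof (hk G hG)⟩⟩
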